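/- Let $\Delta\ge 3$ be fixed. For each $n$ let $G_n$ be a graph on $n$ vertices of maximum degree at most $\Delta$, and let $\lambda_n\ge 0$ satisfy $n\lambda_n\to\infty$ as $n\to\infty$ and $\lambda_n\le \frac{1}{100\Delta^2}$ for all $n$. Let $I_n$ be a random independent set of $G_n$ drawn from the hard-core model at fugacity $\lambda_n$, that is, $\mathbb{P}[I_n=I]=\lambda_n^{|I|}/Z_{G_n}(\lambda_n)$ for every independent set $I$ of $G_n$, where $Z_{G_n}(\lambda)=\sum_{I}\lambda^{|I|}$ is the sum over all independent sets of $G_n$. Let $Y_n=|I_n|$, $\mu_n=\mathbb{E}\,Y_n$ and $\sigma_n^2=\operatorname{Var}(Y_n)$. Then $Y_n$ satisfies a local central limit theorem: as $n\to\infty$, \[ \sup_{k\in\mathbb{Z}}\left|\mathbb{P}[Y_n=k]-\frac{1}{\sqrt{2\pi}\,\sigma_n}e^{-(k-\mu_n)^2/(2\sigma_n^2)}\right| = o\left(\sigma_n^{-1}\right). \] -/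

import Mathlib

open MeasureTheory ProbabilityTheory Filter Topology
open scoped NNReal ENNReal

/-- The independent sets of a graph. -/
def IndepSet {V : Type*} (G : SimpleGraph V) : Type _ :=
  {I : Finset V // G.IsIndepSet (I : Set V)}

namespace IndepSet

variable {V : Type*} {G : SimpleGraph V}

noncomputable instance [Finite V] : Fintype (IndepSet G) :=
  @Fintype.ofFinite _ (inferInstanceAs (Finite {I : Finset V // G.IsIndepSet (I : Set V)}))

/-- The finite set of independent sets carries the discrete σ-algebra. -/
instance : MeasurableSpace (IndepSet G) := ⊤

/-- The number of vertices of an independent set. -/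
def size (I : IndepSet G) : ℕ := I.1.card

/-- The empty independent set. -/
def empty : IndepSet G := ⟨∅, by simp [SimpleGraph.IsIndepSet]⟩

end IndepSet

/-- The independence polynomial `Z_G(z) = ∑_I z^|I|`, the sum being over the independent sets. -/
noncomputable def indepPoly {V : Type*} [Finite V] (G : SimpleGraph V) {R : Type*}
    [CommSemiring R] (z : R) : R :=
  ∑ I : IndepSet G, z ^ I.size

/-- The hard-core model on `G` at fugacity `lam ≥ 0`: the independent set `I` has probability
`lam^|I| / Z_G(lam)`. -/
noncomputable def hardCore {V : Type*} [Finite V] (G : SimpleGraph V) (lam : ℝ≥0) :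
    Measure (IndepSet G) :=
  ∑ I : IndepSet G, ((lam ^ I.size / indepPoly G lam : ℝ≥0) : ℝ≥0∞) • Measure.dirac I

theorem indepPoly_pos {V : Type*} [Finite V] (G : SimpleGraph V) (lam : ℝ≥0) :
    0 < indepPoly G lam := by
  have h : lam ^ (IndepSet.empty : IndepSet G).size ≤ indepPoly G lam :=
    Finset.single_le_sum (f := fun I : IndepSet G => lam ^ I.size)
      (fun _ _ => zero_le) (Finset.mem_univ _)
  refine lt_of_lt_of_le ?_ h
  simp [IndepSet.size, IndepSet.empty]

instance {V : Type*} [Finite V] (G : SimpleGraph V) (lam : ℝ≥0) :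
    IsProbabilityMeasure (hardCore G lam) := by
  constructor
  simp only [hardCore, Measure.coe_finsetSum, Finset.sum_apply, Measure.smul_apply,
    measure_univ, smul_eq_mul, mul_one]
  rw [← ENNReal.ofNNReal_finsetSum, ← Finset.sum_div]
  exact_mod_cast div_self (indepPoly_pos G lam).ne'

/-- A sequence of integer-valued random variables `X n`, with means `μ n` and variances `(σ n)²`,
satisfies a local central limit theorem if
`P[X n = k] = exp (-(k - μ n)² / (2 (σ n)²)) / (√(2π) σ n) + o(1 / σ n)`
as `n → ∞`, uniformly in the integer `k`. -/
def SatisfiesLCLT {Ω : ℕ → Type*} [∀ n, MeasurableSpace (Ω n)] (P : ∀ n, Measure (Ω n))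
    [∀ n, IsProbabilityMeasure (P n)] (X : ∀ n, Ω n → ℤ) : Prop :=
  let μ : ℕ → ℝ := fun n => ∫ ω, (X n ω : ℝ) ∂(P n)
  let σ : ℕ → ℝ := fun n => √(variance (fun ω => (X n ω : ℝ)) (P n))
  ∀ ε : ℝ, 0 < ε → ∀ᶠ n in atTop, ∀ k : ℤ,
    |(P n).real {ω | X n ω = k} -
        1 / (√(2 * Real.pi) * σ n) * Real.exp (-(((k : ℝ) - μ n) ^ 2) / (2 * σ n ^ 2))|
      ≤ ε * (σ n)⁻¹

/-! Write N = nλ. The characteristic function of |I| is Z(λ e^{it}) / Z(λ), so everything follows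
from control of log Z near 0. The recursion Z_{S+v} = Z_S + z Z_{S∖N(v)} shows by induction that Z
has no zeros for |z| ≤ 1/(4Δ), and that adding a vertex changes log Z by at most 3|z|
(`exists_log_indepPolyOn`). Hence |log Z(z)| ≤ 3n|z| on the open disc, and Cauchy's estimates bound
its Taylor coefficients.

Since λ is far inside the disc, log of the characteristic function is ∑ u_j (e^{i(j+1)t} - 1) with
u_0 = N and |u_j| ≤ 3N / 60^j: a Poisson law of mean N, up to a small perturbation. This has three
consequences, collected in `hardCore_charFun_bounds`: the variance ∑ (j+1)² u_j is within N/2 of N,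
hence tends to infinity; the cubic error in the expansion of the logarithm at t = 0 is O(N|t|³),
which gives the central limit theorem at scale t = s/σ; and the modulus is at most exp(-(N/2)(1 -
cos t)) for every t.

The last bound is Gaussian on the whole period |t| ≤ π. It dominates the Fourier inversion integral,
so pointwise convergence of characteristic functions upgrades to the local limit theorem
(`eventually_abs_measureReal_sub_gaussian_le`). -/

section Graph

/-! ### Independence polynomials: zero-free disc and analytic logarithm -/

variable {V : Type*} (G : SimpleGraph V)

open Classical in
/-- The independence polynomial of the subgraph induced on the finite vertex set `S`. -/
noncomputable def indepPolyOn (S : Finset V) (z : ℂ) : ℂ :=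
  ∑ I ∈ S.powerset, if G.IsIndepSet (I : Set V) then z ^ I.card else 0

open Classical in
/-- The non-neighbours of `v` in `S`. -/
noncomputable def nonNbrs (v : V) (S : Finset V) : Finset V := S.filter fun u => ¬ G.Adj v u

theorem indepPolyOn_empty (z : ℂ) : indepPolyOn G ∅ z = 1 := by
  simp [indepPolyOn, SimpleGraph.IsIndepSet]

theorem isIndepSet_insert_iff [DecidableEq V] (v : V) (I : Finset V) (hv : v ∉ I) :
    G.IsIndepSet ((insert v I : Finset V) : Set V) ↔
      G.IsIndepSet (I : Set V) ∧ ∀ u ∈ I, ¬ G.Adj v u := by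
  simp only [SimpleGraph.IsIndepSet, Finset.coe_insert]
  rw [Set.pairwise_insert_of_notMem (by simpa using hv)]
  simp only [Finset.mem_coe]
  refine and_congr_right fun _ => forall₂_congr fun u _ => ?_
  rw [G.adj_comm u v, and_self]

/-- Split the independent sets according to whether they contain `v`; those that do are `v` together
with an independent set of non-neighbours. -/
theorem indepPolyOn_insert [DecidableEq V] {v : V} {S : Finset V} (hv : v ∉ S) (z : ℂ) :
    indepPolyOn G (insert v S) z = indepPolyOn G S z + z * indepPolyOn G (nonNbrs G v S) z := by
  classical
  unfold indepPolyOn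
  rw [Finset.sum_powerset_insert hv]
  congr 1
  have hp : (nonNbrs G v S).powerset = S.powerset.filter fun I => ∀ u ∈ I, ¬ G.Adj v u := by
    ext I
    simp only [nonNbrs, Finset.mem_powerset, Finset.mem_filter, Finset.subset_iff]
    exact ⟨fun h => ⟨fun u hu => (h hu).1, fun u hu => (h hu).2⟩,
      fun h u hu => ⟨h.1 hu, h.2 u hu⟩⟩
  rw [hp, Finset.sum_filter, Finset.mul_sum]
  refine Finset.sum_congr rfl fun I hI => ?_
  have hvI : v ∉ I := fun h => hv (Finset.mem_powerset.1 hI h)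
  simp only [isIndepSet_insert_iff G v I hvI, Finset.card_insert_of_notMem hvI, pow_succ']
  by_cases h1 : G.IsIndepSet (I : Set V) <;> by_cases h2 : ∀ u ∈ I, ¬ G.Adj v u <;>
    simp [h1, h2]

theorem indepPolyOn_zero (S : Finset V) : indepPolyOn G S 0 = 1 := by
  classical
  induction S using Finset.induction_on with
  | empty => exact indepPolyOn_empty G 0
  | insert v S hv ih => simp [indepPolyOn_insert G hv, ih]

theorem differentiable_indepPolyOn (S : Finset V) : Differentiable ℂ (indepPolyOn G S) := by
  unfold indepPolyOn
  refine Differentiable.fun_sum fun I _ => ?_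
  split_ifs <;> fun_prop

theorem indepPolyOn_univ [Fintype V] (z : ℂ) :
    indepPolyOn G Finset.univ z = indepPoly G z := by
  classical
  unfold indepPolyOn indepPoly
  rw [Finset.powerset_univ, ← Finset.sum_filter]
  symm
  refine Finset.sum_bij (fun I _ => I.1) ?_ ?_ ?_ ?_
  · intro I _
    simpa using I.2
  · intro I _ J _ h
    exact Subtype.ext h
  · intro I hI
    exact ⟨⟨I, by simpa using hI⟩, Finset.mem_univ _, rfl⟩
  · intro I _
    rfl

/-- The degree of every vertex is at most `Δ`, stated for finite sets of neighbours. -/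
def DegreeAtMost (Δ : ℕ) : Prop := ∀ (v : V) (T : Finset V), (∀ u ∈ T, G.Adj v u) → T.card ≤ Δ

variable {G} {Δ : ℕ}

/-- At most Δ vertices are deleted, each costing a factor 1 - 1/(2Δ), and (1 - 1/(2Δ))^Δ ≥ 1/2 by
Bernoulli. The comparison `h` is a hypothesis so that this can serve inside the induction that
proves it. -/
theorem norm_indepPolyOn_nonNbrs_le_of {z : ℂ} (hΔ : 1 ≤ Δ) (hG : DegreeAtMost G Δ)
    {S : Finset V} [DecidableEq V] (v : V)
    (h : ∀ T ⊆ S, (1 - 1 / (2 * (Δ : ℝ))) ^ (S \ T).card * ‖indepPolyOn G T z‖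
      ≤ ‖indepPolyOn G S z‖) :
    ‖indepPolyOn G (nonNbrs G v S) z‖ ≤ 2 * ‖indepPolyOn G S z‖ := by
  classical
  have hΔ' : (1 : ℝ) ≤ Δ := by exact_mod_cast hΔ
  have ha : 1 / (2 * (Δ : ℝ)) ≤ 1 / 2 := by
    apply one_div_le_one_div_of_le <;> linarith
  have ha0 : 0 ≤ 1 / (2 * (Δ : ℝ)) := by positivity
  have hsub : nonNbrs G v S ⊆ S := Finset.filter_subset _ _
  have hcard : (S \ nonNbrs G v S).card ≤ Δ := by
    refine hG v _ fun u hu => ?_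
    simp only [nonNbrs, Finset.mem_sdiff, Finset.mem_filter, not_and, not_not] at hu
    exact hu.2 hu.1
  have hbern : (1 / 2 : ℝ) ≤ (1 - 1 / (2 * (Δ : ℝ))) ^ Δ := by
    have := one_add_mul_le_pow (a := -(1 / (2 * (Δ : ℝ)))) (by linarith) Δ
    have e : (Δ : ℝ) * (1 / (2 * (Δ : ℝ))) = 1 / 2 := by field_simp
    rw [← sub_eq_add_neg] at this
    linarith
  have hpow : (1 / 2 : ℝ) ≤ (1 - 1 / (2 * (Δ : ℝ))) ^ (S \ nonNbrs G v S).card :=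
    hbern.trans (pow_le_pow_of_le_one (by linarith) (by linarith) hcard)
  have := h _ hsub
  have h2 := mul_le_mul_of_nonneg_right hpow (norm_nonneg (indepPolyOn G (nonNbrs G v S) z))
  linarith

/-- Remove one vertex u of S∖T. By induction the term z Z_{nonNbrs} in the recursion has norm at
most 2|z| ≤ 1/(2Δ) times that of Z_{S-u}, so one deletion costs only the factor 1 - 1/(2Δ). -/
theorem norm_indepPolyOn_subset_le [DecidableEq V] {z : ℂ} (hΔ : 1 ≤ Δ) (hG : DegreeAtMost G Δ)
    (hz : ‖z‖ ≤ 1 / (4 * (Δ : ℝ))) (S : Finset V) :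
    ∀ T ⊆ S, (1 - 1 / (2 * (Δ : ℝ))) ^ (S \ T).card * ‖indepPolyOn G T z‖
      ≤ ‖indepPolyOn G S z‖ := by
  have hΔ' : (1 : ℝ) ≤ Δ := by exact_mod_cast hΔ
  have ha : 1 / (2 * (Δ : ℝ)) ≤ 1 / 2 := by
    apply one_div_le_one_div_of_le <;> linarith
  have hza : 2 * ‖z‖ ≤ 1 / (2 * (Δ : ℝ)) := by
    have : 1 / (2 * (Δ : ℝ)) = 2 * (1 / (4 * (Δ : ℝ))) := by field_simp; norm_num
    linarith
  induction S using Finset.strongInduction with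
  | H S ih =>
    intro T hT
    rcases hT.eq_or_ssubset with rfl | hss
    · simp
    obtain ⟨u, huS, huT⟩ := Finset.exists_of_ssubset hss
    have hT' : T ⊆ S.erase u := Finset.subset_erase.2 ⟨hT, huT⟩
    have ih' := ih _ (Finset.erase_ssubset huS)
    have hN := norm_indepPolyOn_nonNbrs_le_of hΔ hG u ih'
    have hrec := indepPolyOn_insert G (Finset.notMem_erase u S) z
    rw [Finset.insert_erase huS] at hrec
    have hlow : (1 - 1 / (2 * (Δ : ℝ))) * ‖indepPolyOn G (S.erase u) z‖ ≤ ‖indepPolyOn G S z‖ := by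
      rw [hrec]
      have h1 := norm_sub_le_norm_add (indepPolyOn G (S.erase u) z)
        (z * indepPolyOn G (nonNbrs G u (S.erase u)) z)
      rw [norm_mul] at h1
      have h2 := mul_le_mul_of_nonneg_left hN (norm_nonneg z)
      have h3 := mul_le_mul_of_nonneg_right hza (norm_nonneg (indepPolyOn G (S.erase u) z))
      linarith
    have hc : (S \ T).card = (S.erase u \ T).card + 1 := by
      rw [Finset.erase_sdiff_comm, Finset.card_erase_add_one (by simp [huS, huT])]
    rw [hc, pow_succ']
    calc _ = (1 - 1 / (2 * (Δ : ℝ))) *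
        ((1 - 1 / (2 * (Δ : ℝ))) ^ (S.erase u \ T).card * ‖indepPolyOn G T z‖) := by ring
      _ ≤ (1 - 1 / (2 * (Δ : ℝ))) * ‖indepPolyOn G (S.erase u) z‖ :=
        mul_le_mul_of_nonneg_left (ih' T hT') (by linarith)
      _ ≤ _ := hlow

theorem norm_indepPolyOn_nonNbrs_le {z : ℂ} (hΔ : 1 ≤ Δ) (hG : DegreeAtMost G Δ)
    (hz : ‖z‖ ≤ 1 / (4 * (Δ : ℝ))) (v : V) (S : Finset V) :
    ‖indepPolyOn G (nonNbrs G v S) z‖ ≤ 2 * ‖indepPolyOn G S z‖ := by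
  classical
  exact norm_indepPolyOn_nonNbrs_le_of hΔ hG v (norm_indepPolyOn_subset_le hΔ hG hz S)

theorem indepPolyOn_ne_zero {z : ℂ} (hΔ : 1 ≤ Δ) (hG : DegreeAtMost G Δ)
    (hz : ‖z‖ ≤ 1 / (4 * (Δ : ℝ))) (S : Finset V) : indepPolyOn G S z ≠ 0 := by
  classical
  have hΔ' : (1 : ℝ) ≤ Δ := by exact_mod_cast hΔ
  have ha : 1 / (2 * (Δ : ℝ)) ≤ 1 / 2 := by
    apply one_div_le_one_div_of_le <;> linarith
  have h := norm_indepPolyOn_subset_le hΔ hG hz S ∅ (Finset.empty_subset S)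
  rw [indepPolyOn_empty, norm_one, mul_one] at h
  have : 0 < (1 - 1 / (2 * (Δ : ℝ))) ^ (S \ ∅).card := pow_pos (by linarith) _
  exact norm_pos_iff.1 (this.trans_le h)

/-- On the disc of radius `1 / (4 Δ)` the independence polynomial has an analytic logarithm,
of size at most linear in the number of vertices. -/
theorem exists_log_indepPolyOn (hΔ : 1 ≤ Δ) (hG : DegreeAtMost G Δ) (S : Finset V) :
    ∃ h : ℂ → ℂ, DifferentiableOn ℂ h (Metric.ball 0 (1 / (4 * (Δ : ℝ)))) ∧ h 0 = 0 ∧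
      HasDerivAt h (S.card : ℂ) 0 ∧
      ∀ z ∈ Metric.ball (0 : ℂ) (1 / (4 * (Δ : ℝ))),
        Complex.exp (h z) = indepPolyOn G S z ∧ ‖h z‖ ≤ 3 * S.card * ‖z‖ := by
  classical
  have hΔ' : (1 : ℝ) ≤ Δ := by exact_mod_cast hΔ
  have hR : 1 / (4 * (Δ : ℝ)) ≤ 1 / 4 := by
    apply one_div_le_one_div_of_le <;> linarith
  induction S using Finset.induction_on with
  | empty =>
    refine ⟨fun _ => 0, by fun_prop, rfl, by simpa using hasDerivAt_const (0 : ℂ) (0 : ℂ), ?_⟩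
    intro z _
    simp [indepPolyOn_empty]
  | insert v S hv ih =>
    obtain ⟨h, hd, h0, hd0, hz⟩ := ih
    -- Adding v multiplies the polynomial by 1 + z g(z) with |z g(z)| ≤ 1/2, so the principal branch
    -- of the logarithm applies to this factor, though not necessarily to the product.
    set g : ℂ → ℂ := fun z => indepPolyOn G (nonNbrs G v S) z / indepPolyOn G S z with hg
    have hne : ∀ z ∈ Metric.ball (0 : ℂ) (1 / (4 * (Δ : ℝ))), indepPolyOn G S z ≠ 0 :=
      fun z hz => indepPolyOn_ne_zero hΔ hG (by simpa using (mem_ball_zero_iff.1 hz).le) S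
    have hgb : ∀ z ∈ Metric.ball (0 : ℂ) (1 / (4 * (Δ : ℝ))), ‖g z‖ ≤ 2 := by
      intro z hz
      rw [hg]
      simp only [norm_div]
      rw [div_le_iff₀ (norm_pos_iff.2 (hne z hz))]
      exact norm_indepPolyOn_nonNbrs_le hΔ hG (mem_ball_zero_iff.1 hz).le v S
    have hzg : ∀ z ∈ Metric.ball (0 : ℂ) (1 / (4 * (Δ : ℝ))),
        ‖z * g z‖ ≤ 2 * ‖z‖ ∧ ‖z * g z‖ ≤ 1 / 2 ∧ ‖z * g z‖ < 1 := by
      intro z hz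
      have h1 : ‖z * g z‖ ≤ 2 * ‖z‖ := by
        rw [norm_mul]
        nlinarith [hgb z hz, norm_nonneg z]
      have := mem_ball_zero_iff.1 hz
      exact ⟨h1, by linarith, by linarith⟩
    have hgd : ∀ z ∈ Metric.ball (0 : ℂ) (1 / (4 * (Δ : ℝ))), DifferentiableAt ℂ g z :=
      fun z hz => (differentiable_indepPolyOn G _ z).div (differentiable_indepPolyOn G _ z)
        (hne z hz)
    have h0mem : (0 : ℂ) ∈ Metric.ball (0 : ℂ) (1 / (4 * (Δ : ℝ))) := by
      simp; positivity
    refine ⟨fun z => h z + Complex.log (1 + z * g z), ?_, by simp [h0], ?_, ?_⟩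
    · refine hd.add fun z hz => DifferentiableAt.differentiableWithinAt ?_
      refine DifferentiableAt.clog ?_ (Complex.mem_slitPlane_of_norm_lt_one (hzg z hz).2.2)
      have := hgd z hz
      fun_prop
    · have hg0 : g 0 = 1 := by simp [hg, indepPolyOn_zero]
      have e1 : HasDerivAt (fun z => 1 + z * g z) 1 0 := by
        have := ((hasDerivAt_id (0 : ℂ)).mul (hgd 0 h0mem).hasDerivAt).const_add 1
        simpa [hg0] using this
      have e2 := e1.clog (by simp)
      have := hd0.fun_add e2
      rw [Finset.card_insert_of_notMem hv]
      push_cast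
      simpa using this
    · intro z hzm
      obtain ⟨h1, h2⟩ := hz z hzm
      obtain ⟨h3, h4, h5⟩ := hzg z hzm
      constructor
      · rw [Complex.exp_add, Complex.exp_log (Complex.slitPlane_ne_zero
          (Complex.mem_slitPlane_of_norm_lt_one h5)), h1, indepPolyOn_insert G hv]
        have := hne z hzm
        simp only [hg]
        field_simp
      · rw [Finset.card_insert_of_notMem hv]
        -- |log(1 + w)| ≤ (3/2)|w| and |w| ≤ 2|z|: this is the 3 per vertex.
        have := Complex.norm_log_one_add_half_le_self h4
        have := norm_add_le (h z) (Complex.log (1 + z * g z))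
        push_cast
        linarith

end Graph

/-! ### Taylor expansion of the logarithm -/

/-- The characteristic function of the size of a hard-core random set is the exponential of a
rapidly converging trigonometric series. -/
theorem exists_trigSeries_log_indepPoly {V : Type*} [Fintype V] {G : SimpleGraph V} {Δ : ℕ}
    (hΔ : 3 ≤ Δ) (hG : DegreeAtMost G Δ) {lam : ℝ} (h0 : 0 ≤ lam)
    (hlam : lam ≤ 1 / (100 * (Δ : ℝ) ^ 2)) :
    ∃ u : ℕ → ℂ, u 0 = ((Fintype.card V * lam : ℝ) : ℂ) ∧
      (∀ j, ‖u j‖ ≤ 3 * (Fintype.card V * lam) * (1 / 60) ^ j) ∧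
      ∀ t : ℝ, indepPoly G ((lam : ℂ) * Complex.exp (t * Complex.I)) =
        indepPoly G (lam : ℂ) *
          Complex.exp (∑' j : ℕ, u j * (Complex.exp (((j + 1) * t : ℝ) * Complex.I) - 1)) := by
  have hΔ' : (3 : ℝ) ≤ Δ := by exact_mod_cast hΔ
  obtain ⟨h, hd, hh0, hd0, hz⟩ := exists_log_indepPolyOn (by lia) hG Finset.univ
  simp only [indepPolyOn_univ, Finset.card_univ] at hd0 hz
  set n := Fintype.card V
  -- A radius strictly inside the disc for Cauchy's estimate; λ/r ≤ 1/(20Δ) ≤ 1/60 because Δ ≥ 3.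
  set r : ℝ := 1 / (5 * (Δ : ℝ)) with hr
  have hr0 : 0 < r := by positivity
  have hrR : r < 1 / (4 * (Δ : ℝ)) := by
    apply one_div_lt_one_div_of_lt <;> linarith
  have hlr : lam ≤ r * (1 / 60) := by
    refine hlam.trans ?_
    rw [hr, one_div_mul_one_div]
    apply one_div_le_one_div_of_le (by positivity)
    nlinarith
  have hdr : lam / r ≤ 1 / 60 := by
    rw [div_le_iff₀ hr0]; linarith
  clear_value r
  set c : ℕ → ℂ := fun k => ((k.factorial : ℂ))⁻¹ * iteratedDeriv k h 0 with hc
  have hc0 : c 0 = 0 := by simp [hc, hh0]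
  have hc1 : c 1 = n := by simp [hc, iteratedDeriv_one, hd0.deriv]
  have hcl : Metric.closedBall (0 : ℂ) r ⊆ Metric.ball 0 (1 / (4 * (Δ : ℝ))) :=
    Metric.closedBall_subset_ball hrR
  have hcb : ∀ k, ‖c k‖ ≤ 3 * n * r / r ^ k := by
    intro k
    have := Complex.norm_iteratedDeriv_le_of_forall_mem_sphere_norm_le (f := h) (c := 0)
      (C := 3 * n * r) k hr0
      (DifferentiableOn.diffContOnCl (by rw [closure_ball _ hr0.ne']; exact hd.mono hcl))
      (fun z hzs => by
        have := (hz z (hcl (Metric.sphere_subset_closedBall hzs))).2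
        rwa [mem_sphere_zero_iff_norm.1 hzs] at this)
    rw [hc]
    simp only [norm_mul, norm_inv, Complex.norm_natCast]
    rw [inv_mul_le_iff₀ (by positivity)]
    rwa [← mul_div_assoc]
  have hsum : ∀ z : ℂ, ‖z‖ ≤ r → HasSum (fun j => c (j + 1) * z ^ (j + 1)) (h z) := by
    intro z hzr
    have := Complex.hasSum_taylorSeries_on_ball hd (hcl (mem_closedBall_zero_iff.2 hzr))
    have h2 : HasSum (fun k => c k * z ^ k) (h z) := by
      refine this.congr_fun ?_
      intro k
      simp only [hc, sub_zero, smul_eq_mul]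
      ring
    have h3 := (hasSum_nat_add_iff' 1).2 h2
    simpa [hc0] using h3
  have hlamr : lam ≤ r := hlr.trans (by linarith)
  -- The constant Taylor coefficient vanishes, so indices shift by one and u_0 = c_1 λ = nλ.
  refine ⟨fun j => c (j + 1) * (lam : ℂ) ^ (j + 1), ?_, ?_, ?_⟩
  · simp [hc1]
  · intro j
    rw [norm_mul, norm_pow, Complex.norm_real, Real.norm_of_nonneg h0]
    calc ‖c (j + 1)‖ * lam ^ (j + 1) ≤ (3 * n * r / r ^ (j + 1)) * lam ^ (j + 1) := by
          gcongr; exact hcb _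
      _ = 3 * (n * lam) * (lam / r) ^ j := by
          rw [div_pow, pow_succ, pow_succ]; field_simp
      _ ≤ 3 * (n * lam) * (1 / 60) ^ j := by
          gcongr 3 * (n * lam) * ?_ ^ j
  · intro t
    have hn1 : ‖(lam : ℂ) * Complex.exp (t * Complex.I)‖ ≤ r := by
      rw [norm_mul, Complex.norm_exp_ofReal_mul_I, Complex.norm_real, Real.norm_of_nonneg h0,
        mul_one]
      exact hlamr
    have hn2 : ‖(lam : ℂ)‖ ≤ r := by
      rwa [Complex.norm_real, Real.norm_of_nonneg h0]
    have e : ∑' j : ℕ, c (j + 1) * (lam : ℂ) ^ (j + 1) *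
        (Complex.exp (((j + 1) * t : ℝ) * Complex.I) - 1) =
        h ((lam : ℂ) * Complex.exp (t * Complex.I)) - h lam := by
      refine (((hsum _ hn1).sub (hsum _ hn2)).congr_fun ?_).tsum_eq
      intro j
      rw [mul_pow, ← Complex.exp_nat_mul]
      push_cast
      ring_nf
    rw [e, ← (hz _ (hcl (mem_closedBall_zero_iff.2 hn1))).1,
      ← (hz _ (hcl (mem_closedBall_zero_iff.2 hn2))).1, ← Complex.exp_add]
    congr 1
    ring

/-! ### Exponentials of rapidly converging trigonometric series -/

section TrigSeries

theorem abs_sin_nat_mul_le (k : ℕ) (x : ℝ) : |Real.sin (k * x)| ≤ k * |Real.sin x| := by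
  induction k with
  | zero => simp
  | succ k ih =>
    have e : ((k + 1 : ℕ) : ℝ) * x = k * x + x := by push_cast; ring
    rw [e, Real.sin_add]
    have h1 := abs_add_le (Real.sin (k * x) * Real.cos x) (Real.cos (k * x) * Real.sin x)
    rw [abs_mul, abs_mul] at h1
    have h2 := mul_le_of_le_one_right (abs_nonneg (Real.sin (k * x))) (Real.abs_cos_le_one x)
    have h3 := mul_le_of_le_one_left (abs_nonneg (Real.sin x)) (Real.abs_cos_le_one (k * x))
    push_cast
    linarith

/-- Follows from 1 - cos y = 2 sin²(y/2) and |sin kx| ≤ k|sin x|. It lets the first harmonic control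
all higher ones, uniformly in t. -/
theorem one_sub_cos_nat_mul_le (k : ℕ) (t : ℝ) :
    1 - Real.cos (k * t) ≤ (k : ℝ) ^ 2 * (1 - Real.cos t) := by
  have key : ∀ y : ℝ, 1 - Real.cos y = 2 * |Real.sin (y / 2)| ^ 2 := by
    intro y
    have := Real.cos_sq' (y / 2)
    have h2 := Real.cos_two_mul (y / 2)
    rw [mul_div_cancel₀ y two_ne_zero] at h2
    rw [sq_abs]
    linarith
  rw [key, key t]
  have h := abs_sin_nat_mul_le k (t / 2)
  rw [← mul_div_assoc] at h
  have := pow_le_pow_left₀ (abs_nonneg _) h 2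
  rw [mul_pow] at this
  linarith

theorem norm_exp_mul_I_sub_quadratic_le (x : ℝ) :
    ‖Complex.exp (x * Complex.I) - 1 - (x * Complex.I - (x : ℂ) ^ 2 / 2)‖ ≤ 4 * |x| ^ 3 := by
  have hxn : ‖(x : ℂ) * Complex.I‖ = |x| := by simp
  rcases le_total |x| 1 with hx | hx
  · have h := Complex.norm_exp_sub_sum_le_norm_mul_exp ((x : ℂ) * Complex.I) 3
    rw [hxn] at h
    have e : Complex.exp (x * Complex.I) - 1 - (x * Complex.I - (x : ℂ) ^ 2 / 2) =
        Complex.exp (x * Complex.I) -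
          ∑ m ∈ Finset.range 3, ((x : ℂ) * Complex.I) ^ m / (m.factorial : ℂ) := by
      simp only [Finset.sum_range_succ, Finset.sum_range_zero, Nat.factorial, mul_pow,
        Complex.I_sq]
      push_cast
      ring
    rw [e]
    refine h.trans ?_
    rw [mul_comm]
    gcongr
    have := Real.exp_one_lt_d9
    have := Real.exp_le_exp.2 hx
    linarith
  · have h1 : ‖Complex.exp (x * Complex.I) - 1 - (x * Complex.I - (x : ℂ) ^ 2 / 2)‖ ≤
        1 + 1 + (|x| + |x| ^ 2 / 2) := by
      refine (norm_sub_le _ _).trans (add_le_add ((norm_sub_le _ _).trans ?_)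
        ((norm_sub_le _ _).trans ?_))
      · simp [Complex.norm_exp_ofReal_mul_I]
      · simp
    have h2 : (1 : ℝ) ≤ |x| ^ 2 := one_le_pow₀ hx
    nlinarith

variable {u : ℕ → ℂ} {N : ℝ}

/-- Since j + 1 ≤ 2^j, polynomial weights only enlarge the geometric ratio; it stays below 1 for the
p ≤ 3 needed later. -/
theorem succ_pow_mul_pow_le (p j : ℕ) :
    ((j : ℝ) + 1) ^ p * (1 / 60) ^ j ≤ (2 ^ p / 60) ^ j := by
  have h : ((j : ℝ) + 1) ≤ 2 ^ j := by exact_mod_cast Nat.lt_two_pow_self (n := j)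
  calc ((j : ℝ) + 1) ^ p * (1 / 60) ^ j ≤ (2 ^ j) ^ p * (1 / 60) ^ j := by gcongr
    _ = (2 ^ p / 60) ^ j := by rw [← pow_mul, mul_comm j p, pow_mul, ← mul_pow]; ring

theorem norm_mul_succ_pow_le (hN : 0 ≤ N) (hu : ∀ j, ‖u j‖ ≤ 3 * N * (1 / 60) ^ j) (p j : ℕ) :
    ‖u j‖ * ((j : ℝ) + 1) ^ p ≤ 3 * N * (2 ^ p / 60) ^ j := by
  calc ‖u j‖ * ((j : ℝ) + 1) ^ p ≤ 3 * N * (1 / 60) ^ j * ((j : ℝ) + 1) ^ p := by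
        gcongr; exact hu j
    _ = 3 * N * (((j : ℝ) + 1) ^ p * (1 / 60) ^ j) := by ring
    _ ≤ _ := by gcongr; exact succ_pow_mul_pow_le p j

theorem summable_norm_mul_succ_pow (hN : 0 ≤ N) (hu : ∀ j, ‖u j‖ ≤ 3 * N * (1 / 60) ^ j)
    {p : ℕ} (hp : p ≤ 3) : Summable fun j : ℕ => ‖u j‖ * ((j : ℝ) + 1) ^ p := by
  refine Summable.of_nonneg_of_le (fun j => by positivity) (norm_mul_succ_pow_le hN hu p)
    (Summable.mul_left _ (summable_geometric_of_lt_one (by positivity) ?_))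
  have : (2 : ℝ) ^ p ≤ 2 ^ 3 := pow_le_pow_right₀ (by norm_num) hp
  linarith

/-- The ratio is 4/60 = 1/15, and the geometric tail sums to 3N/14. Being below N, it leaves the
leading term u_0 = N in command of both the variance and the decay. -/
theorem tsum_norm_mul_succ_sq_tail_le (hN : 0 ≤ N) (hu : ∀ j, ‖u j‖ ≤ 3 * N * (1 / 60) ^ j) :
    ∑' j : ℕ, ‖u (j + 1)‖ * (((j + 1 : ℕ) : ℝ) + 1) ^ 2 ≤ N / 2 := by
  have hs := (summable_nat_add_iff 1).2 (summable_norm_mul_succ_pow hN hu (p := 2) (by norm_num))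
  have hg : HasSum (fun j : ℕ => 3 * N * (1 / 15 : ℝ) ^ (j + 1)) (3 * N / 14) := by
    have := (hasSum_geometric_of_lt_one (r := (1 / 15 : ℝ)) (by norm_num) (by norm_num)).mul_left
      (3 * N * (1 / 15))
    rw [show 3 * N / 14 = 3 * N * (1 / 15) * (1 - 1 / 15)⁻¹ by norm_num; ring]
    exact this.congr_fun fun j => by ring
  refine (hs.tsum_le_tsum (fun j => ?_) hg.summable).trans (by rw [hg.tsum_eq]; linarith)
  have := norm_mul_succ_pow_le hN hu 2 (j + 1)
  norm_num at this ⊢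
  exact this

theorem tsum_norm_mul_succ_cube_le (hN : 0 ≤ N) (hu : ∀ j, ‖u j‖ ≤ 3 * N * (1 / 60) ^ j) :
    ∑' j : ℕ, ‖u j‖ * ((j : ℝ) + 1) ^ 3 ≤ 4 * N := by
  have hg : HasSum (fun j : ℕ => 3 * N * (2 / 15 : ℝ) ^ j) (3 * N * (15 / 13)) := by
    have := (hasSum_geometric_of_lt_one (r := (2 / 15 : ℝ)) (by norm_num) (by norm_num)).mul_left
      (3 * N)
    rwa [show (1 - 2 / 15 : ℝ)⁻¹ = 15 / 13 by norm_num] at this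
  refine ((summable_norm_mul_succ_pow hN hu (p := 3) le_rfl).tsum_le_tsum (fun j => ?_)
    hg.summable).trans (by rw [hg.tsum_eq]; linarith)
  have := norm_mul_succ_pow_le hN hu 3 j
  norm_num at this ⊢
  exact this

theorem summable_mul_succ_pow (hN : 0 ≤ N) (hu : ∀ j, ‖u j‖ ≤ 3 * N * (1 / 60) ^ j)
    {p : ℕ} (hp : p ≤ 3) : Summable fun j : ℕ => u j * ((j : ℂ) + 1) ^ p := by
  refine Summable.of_norm ((summable_norm_mul_succ_pow hN hu hp).congr fun j => ?_)
  rw [norm_mul, norm_pow]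
  congr 2
  exact_mod_cast (Complex.norm_natCast (j + 1)).symm

theorem norm_exp_mul_I_sub_one_le_two (x : ℝ) : ‖Complex.exp (x * Complex.I) - 1‖ ≤ 2 := by
  refine (norm_sub_le _ _).trans ?_
  simp [Complex.norm_exp_ofReal_mul_I]
  norm_num

theorem summable_mul_exp_sub_one (hN : 0 ≤ N) (hu : ∀ j, ‖u j‖ ≤ 3 * N * (1 / 60) ^ j) (t : ℝ) :
    Summable fun j : ℕ => u j * (Complex.exp (((j + 1) * t : ℝ) * Complex.I) - 1) := by
  refine Summable.of_norm_bounded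
    ((summable_norm_mul_succ_pow hN hu (p := 0) (by norm_num)).mul_left 2) fun j => ?_
  rw [norm_mul, pow_zero, mul_one, mul_comm]
  gcongr
  exact norm_exp_mul_I_sub_one_le_two _

/-- The series `∑ (j + 1)² u_j` is dominated by its first term. -/
theorem norm_tsum_mul_succ_sq_sub_le (hN : 0 ≤ N) (hu : ∀ j, ‖u j‖ ≤ 3 * N * (1 / 60) ^ j)
    (h0 : u 0 = N) : ‖(∑' j : ℕ, u j * ((j : ℂ) + 1) ^ 2) - (N : ℂ)‖ ≤ N / 2 := by
  rw [(summable_mul_succ_pow hN hu (p := 2) (by norm_num)).tsum_eq_zero_add, h0]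
  have e : ∀ j : ℕ, ‖u (j + 1) * (((j + 1 : ℕ) : ℂ) + 1) ^ 2‖ =
      ‖u (j + 1)‖ * (((j + 1 : ℕ) : ℝ) + 1) ^ 2 := by
    intro j
    rw [norm_mul, norm_pow]
    congr 2
    exact_mod_cast (Complex.norm_natCast (j + 1 + 1))
  have := norm_tsum_le_tsum_norm (f := fun j : ℕ => u (j + 1) * (((j + 1 : ℕ) : ℂ) + 1) ^ 2)
    (by simp only [e]
        exact (summable_nat_add_iff 1).2 (summable_norm_mul_succ_pow hN hu (p := 2) (by norm_num)))
  simp only [e] at this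
  simpa using this.trans (tsum_norm_mul_succ_sq_tail_le hN hu)

/-- Second order expansion at the origin of a trigonometric series. -/
theorem norm_trigSeries_sub_quadratic_le (hN : 0 ≤ N) (hu : ∀ j, ‖u j‖ ≤ 3 * N * (1 / 60) ^ j)
    (t : ℝ) :
    ‖(∑' j : ℕ, u j * (Complex.exp (((j + 1) * t : ℝ) * Complex.I) - 1)) -
      ((∑' j : ℕ, u j * ((j : ℂ) + 1) ^ 1) * t * Complex.I -
        (∑' j : ℕ, u j * ((j : ℂ) + 1) ^ 2) * t ^ 2 / 2)‖ ≤ 16 * N * |t| ^ 3 := by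
  have s1 := (summable_mul_succ_pow hN hu (p := 1) (by norm_num)).hasSum.mul_right
    ((t : ℂ) * Complex.I)
  have s2 := (summable_mul_succ_pow hN hu (p := 2) (by norm_num)).hasSum.mul_right ((t : ℂ) ^ 2 / 2)
  have s := (summable_mul_exp_sub_one hN hu t).hasSum.sub (s1.sub s2)
  have s3 := ((summable_norm_mul_succ_pow hN hu (p := 3) le_rfl).hasSum.mul_left (4 * |t| ^ 3))
  have hb := tsum_of_norm_bounded s3 (f := fun j : ℕ =>
    u j * (Complex.exp (((j + 1) * t : ℝ) * Complex.I) - 1) -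
      (u j * ((j : ℂ) + 1) ^ 1 * ((t : ℂ) * Complex.I) -
        u j * ((j : ℂ) + 1) ^ 2 * ((t : ℂ) ^ 2 / 2)))
    (fun j => by
      have h := norm_exp_mul_I_sub_quadratic_le ((j + 1) * t)
      have e : u j * (Complex.exp (((j + 1) * t : ℝ) * Complex.I) - 1) -
          (u j * ((j : ℂ) + 1) ^ 1 * ((t : ℂ) * Complex.I) -
            u j * ((j : ℂ) + 1) ^ 2 * ((t : ℂ) ^ 2 / 2)) =
          u j * (Complex.exp (((j + 1) * t : ℝ) * Complex.I) - 1 -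
            (((j + 1) * t : ℝ) * Complex.I - (((j + 1) * t : ℝ) : ℂ) ^ 2 / 2)) := by
        push_cast; ring
      rw [e, norm_mul]
      refine (mul_le_mul_of_nonneg_left h (norm_nonneg _)).trans (le_of_eq ?_)
      rw [abs_mul, mul_pow, abs_of_nonneg (by positivity : (0 : ℝ) ≤ (j : ℝ) + 1)]
      ring)
  rw [s.tsum_eq] at hb
  have h4 := mul_le_mul_of_nonneg_left (tsum_norm_mul_succ_cube_le hN hu)
    (by positivity : 0 ≤ 4 * |t| ^ 3)
  calc _ = _ := by congr 1; ring
    _ ≤ _ := hb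
    _ ≤ _ := by linarith

/-- Decay of the modulus of the exponential of a trigonometric series. -/
theorem norm_exp_trigSeries_le (hN : 0 ≤ N) (hu : ∀ j, ‖u j‖ ≤ 3 * N * (1 / 60) ^ j)
    (h0 : u 0 = N) (t : ℝ)
    (hconj : ‖Complex.exp (∑' j : ℕ, u j * (Complex.exp (((j + 1) * (-t) : ℝ) * Complex.I) - 1))‖ =
      ‖Complex.exp (∑' j : ℕ, u j * (Complex.exp (((j + 1) * t : ℝ) * Complex.I) - 1))‖) :
    ‖Complex.exp (∑' j : ℕ, u j * (Complex.exp (((j + 1) * t : ℝ) * Complex.I) - 1))‖ ≤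
      Real.exp (-(N / 2) * (1 - Real.cos t)) := by
  set F : ℝ → ℂ := fun t => ∑' j : ℕ, u j * (Complex.exp (((j + 1) * t : ℝ) * Complex.I) - 1)
    with hF
  change ‖Complex.exp (F t)‖ ≤ _
  change ‖Complex.exp (F (-t))‖ = ‖Complex.exp (F t)‖ at hconj
  rw [Complex.norm_exp, Complex.norm_exp, Real.exp_eq_exp] at hconj
  rw [Complex.norm_exp, Real.exp_le_exp]
  -- By `hconj`, Re F(t) is half the real part of F(t) + F(-t), whose terms are u_j times real
  -- numbers. This avoids proving that the u_j are real.
  have s := (summable_mul_exp_sub_one hN hu t).hasSum.add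
    (summable_mul_exp_sub_one hN hu (-t)).hasSum
  have e : ∀ j : ℕ, u j * (Complex.exp (((j + 1) * t : ℝ) * Complex.I) - 1) +
      u j * (Complex.exp (((j + 1) * (-t) : ℝ) * Complex.I) - 1) =
      u j * ((-2 * (1 - Real.cos (((j + 1 : ℕ) : ℝ) * t)) : ℝ) : ℂ) := by
    intro j
    push_cast
    rw [Complex.cos]
    ring_nf
  simp only [e] at s
  have hs : F t + F (-t) = _ := s.tsum_eq.symm
  rw [s.summable.tsum_eq_zero_add] at hs
  have hc : 0 ≤ 1 - Real.cos t := by linarith [Real.cos_le_one t]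
  have htail := tsum_of_norm_bounded
    (((summable_nat_add_iff 1).2
      (summable_norm_mul_succ_pow hN hu (p := 2) (by norm_num))).hasSum.mul_left
        (2 * (1 - Real.cos t)))
    (f := fun j : ℕ => u (j + 1) * ((-2 * (1 - Real.cos (((j + 1 + 1 : ℕ) : ℝ) * t)) : ℝ) : ℂ))
    (fun j => by
      have h1 := one_sub_cos_nat_mul_le (j + 1 + 1) t
      have h2 : 0 ≤ 1 - Real.cos (((j + 1 + 1 : ℕ) : ℝ) * t) := by
        linarith [Real.cos_le_one (((j + 1 + 1 : ℕ) : ℝ) * t)]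
      rw [norm_mul, Complex.norm_real, Real.norm_eq_abs, abs_mul, abs_of_nonneg h2]
      norm_num only [abs_neg, Nat.abs_ofNat]
      have h3 := mul_le_mul_of_nonneg_left h1 (norm_nonneg (u (j + 1)))
      push_cast at h3 ⊢
      linarith)
  have hb := tsum_norm_mul_succ_sq_tail_le hN hu
  have hb' := mul_le_mul_of_nonneg_left hb (by positivity : 0 ≤ 2 * (1 - Real.cos t))
  have hre := congrArg Complex.re hs
  rw [Complex.add_re, Complex.add_re, h0, Complex.re_ofReal_mul, Complex.ofReal_re, hconj] at hre
  have := (Complex.re_le_norm _).trans (htail.trans hb')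
  simp only [zero_add, Nat.cast_one, one_mul] at hre
  linarith

/-- The constant `d` and the trailing `- 0` keep the derivative in the shape of the original series,
so the lemma applies twice: with d = 1, then d = 0. -/
theorem hasDerivAt_trigSeries {v : ℕ → ℂ}
    (hv : Summable fun j : ℕ => ‖v j‖ * ((j : ℝ) + 1)) (d : ℂ) (t : ℝ) :
    HasDerivAt (fun t : ℝ => ∑' j : ℕ, v j * (Complex.exp (((j + 1) * t : ℝ) * Complex.I) - d))
      (∑' j : ℕ, (v j * (((j : ℂ) + 1) * Complex.I)) *
        (Complex.exp (((j + 1) * t : ℝ) * Complex.I) - 0)) t := by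
  have hder : ∀ (j : ℕ) (y : ℝ),
      HasDerivAt (fun t : ℝ => v j * (Complex.exp (((j + 1) * t : ℝ) * Complex.I) - d))
        ((v j * (((j : ℂ) + 1) * Complex.I)) *
          (Complex.exp (((j + 1) * y : ℝ) * Complex.I) - 0)) y := by
    intro j y
    have h1 : HasDerivAt (fun t : ℝ => ((((j + 1) * t : ℝ) : ℂ) * Complex.I))
        (((j : ℂ) + 1) * Complex.I) y := by
      have := (((hasDerivAt_id y).const_mul ((j : ℝ) + 1)).ofReal_comp).mul_const Complex.I
      simpa using this
    have := (h1.cexp.sub_const d).const_mul (v j)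
    exact this.congr_deriv (by ring)
  refine hasDerivAt_tsum hv hder (fun j y => ?_) (y₀ := 0) ?_ t
  · rw [sub_zero, norm_mul, Complex.norm_exp_ofReal_mul_I, mul_one, norm_mul, norm_mul,
      Complex.norm_I, mul_one]
    gcongr
    exact_mod_cast (Complex.norm_natCast (j + 1)).le
  · have h1 : Summable fun j => ‖v j‖ := hv.of_nonneg_of_le (fun j => norm_nonneg _)
      (fun j => le_mul_of_one_le_right (norm_nonneg _) (by simp))
    simpa using h1.of_norm.mul_right (1 - d)

/-- The first two derivatives at the origin of the exponential of a trigonometric series. -/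
theorem moments_of_eq_exp_trigSeries (hN : 0 ≤ N) (hu : ∀ j, ‖u j‖ ≤ 3 * N * (1 / 60) ^ j)
    {φ φ' : ℝ → ℂ} {m₂ : ℂ} (hφ : ∀ t : ℝ, φ t =
      Complex.exp (∑' j : ℕ, u j * (Complex.exp (((j + 1) * t : ℝ) * Complex.I) - 1)))
    (hd : ∀ t, HasDerivAt φ (φ' t) t) (hd2 : HasDerivAt φ' m₂ 0) :
    φ' 0 = (∑' j : ℕ, u j * ((j : ℂ) + 1) ^ 1) * Complex.I ∧
      m₂ = -(∑' j : ℕ, u j * ((j : ℂ) + 1) ^ 2) + φ' 0 ^ 2 := by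
  set F : ℝ → ℂ := fun t => ∑' j : ℕ, u j * (Complex.exp (((j + 1) * t : ℝ) * Complex.I) - 1)
    with hF
  set F₁ : ℝ → ℂ := fun t => ∑' j : ℕ, (u j * (((j : ℂ) + 1) * Complex.I)) *
    (Complex.exp (((j + 1) * t : ℝ) * Complex.I) - 0) with hF₁
  have hF' : ∀ t, HasDerivAt F (F₁ t) t := hasDerivAt_trigSeries
    ((summable_norm_mul_succ_pow hN hu (p := 1) (by norm_num)).congr fun j => by rw [pow_one]) 1
  have hF'' := hasDerivAt_trigSeries (v := fun j => u j * (((j : ℂ) + 1) * Complex.I))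
    ((summable_norm_mul_succ_pow hN hu (p := 2) (by norm_num)).congr fun j => by
      have : ‖(j : ℂ) + 1‖ = (j : ℝ) + 1 := by exact_mod_cast Complex.norm_natCast (j + 1)
      rw [norm_mul, norm_mul, Complex.norm_I, this]; ring) 0 0
  change HasDerivAt F₁ _ 0 at hF''
  have hφF : φ = fun t => Complex.exp (F t) := funext hφ
  -- Logarithmic derivative; differentiating once more at 0 gives φ'' = F₁' + F₁², as φ(0) = 1.
  have e1 : φ' = fun t => φ t * F₁ t := by
    funext t
    refine (hd t).unique ?_
    rw [hφF]
    exact (hF' t).cexp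
  have hF0 : φ 0 = 1 := by simp [hφ]
  have hF10 : F₁ 0 = (∑' j : ℕ, u j * ((j : ℂ) + 1) ^ 1) * Complex.I := by
    rw [← tsum_mul_right]
    simp [hF₁, mul_assoc]
  have h0 : φ' 0 = F₁ 0 := by rw [e1]; simp [hF0]
  refine ⟨h0.trans hF10, ?_⟩
  have h2 := (hd 0).fun_mul hF''
  have h3 : HasDerivAt (fun t => φ t * F₁ t) m₂ 0 := e1 ▸ hd2
  rw [h3.unique h2, hF0, h0, one_mul, add_comm, sq]
  congr 1
  rw [← tsum_neg]
  refine tsum_congr fun j => ?_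
  simp only [mul_zero, Complex.ofReal_zero, zero_mul, Complex.exp_zero, sub_zero, mul_one]
  linear_combination u j * ((j : ℂ) + 1) ^ 2 * Complex.I_sq

end TrigSeries

/-! ### Fourier inversion and the local limit criterion -/

section LocalLimit

theorem integral_exp_int_mul_I (m : ℤ) :
    ∫ t in (-Real.pi)..Real.pi, Complex.exp ((t * m : ℝ) * Complex.I) =
      if m = 0 then (2 * Real.pi : ℂ) else 0 := by
  split_ifs with h
  · simp [h]; ring
  · have hc : (m : ℂ) * Complex.I ≠ 0 := by simp [h]
    have e : ∀ t : ℝ, Complex.exp ((t * m : ℝ) * Complex.I) =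
        Complex.exp ((m : ℂ) * Complex.I * t) := by
      intro t; congr 1; push_cast; ring
    simp only [e]
    rw [integral_exp_mul_complex hc]
    have : (m : ℂ) * Complex.I * (Real.pi : ℝ) =
        (m : ℂ) * Complex.I * ((-Real.pi : ℝ) : ℂ) + m * (2 * Real.pi * Complex.I) := by
      push_cast; ring
    rw [this, Complex.exp_add, Complex.exp_int_mul_two_pi_mul_I, mul_one, sub_self, zero_div]

variable {Ω : Type*} [MeasurableSpace Ω]

/-- Fourier inversion for integer-valued random variables. -/
theorem measureReal_eq_integral_charFun (P : Measure Ω) [IsProbabilityMeasure P] {X : Ω → ℤ}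
    (hX : Measurable X) (a : ℝ) (k : ℤ) :
    ((P.real {ω | X ω = k} : ℝ) : ℂ) * (2 * Real.pi) =
      ∫ t in (-Real.pi)..Real.pi, Complex.exp ((t * (a - k) : ℝ) * Complex.I) *
        ∫ ω, Complex.exp ((t * (X ω - a) : ℝ) * Complex.I) ∂P := by
  have hXr : Measurable fun ω => (X ω : ℝ) :=
    (measurable_from_top (f := fun m : ℤ => (m : ℝ))).comp hX
  have e : ∀ t : ℝ, Complex.exp ((t * (a - k) : ℝ) * Complex.I) *
        ∫ ω, Complex.exp ((t * (X ω - a) : ℝ) * Complex.I) ∂P =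
      ∫ ω, Complex.exp ((t * (X ω - k : ℤ) : ℝ) * Complex.I) ∂P := by
    intro t
    rw [← integral_const_mul]
    refine integral_congr_ae (ae_of_all _ fun ω => ?_)
    simp only
    rw [← Complex.exp_add]
    congr 1
    push_cast
    ring
  simp only [e]
  rw [intervalIntegral.integral_of_le (by linarith [Real.pi_pos]), integral_integral_swap]
  · have e2 : ∀ ω, ∫ t in Set.Ioc (-Real.pi) Real.pi,
        Complex.exp ((t * (X ω - k : ℤ) : ℝ) * Complex.I) =
        Set.indicator {ω | X ω = k} (fun _ => (2 * Real.pi : ℂ)) ω := by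
      intro ω
      rw [← intervalIntegral.integral_of_le (by linarith [Real.pi_pos]), integral_exp_int_mul_I]
      simp [Set.indicator, sub_eq_zero]
    simp only [e2]
    have hm : MeasurableSet {ω | X ω = k} := hX (measurableSet_singleton k)
    rw [integral_indicator_const _ hm]
    simp
  · refine Integrable.of_bound (C := 1) ?_ (ae_of_all _ fun p => ?_)
    · refine Measurable.aestronglyMeasurable ?_
      simp only [Function.uncurry_def, Int.cast_sub]
      fun_prop
    · simp only [Function.uncurry_def]
      rw [Complex.norm_exp_ofReal_mul_I]

theorem continuous_integral_exp_mul_I (P : Measure Ω) [IsProbabilityMeasure P] {Y : Ω → ℝ}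
    (hY : Measurable Y) :
    Continuous fun t : ℝ => ∫ ω, Complex.exp ((t * Y ω : ℝ) * Complex.I) ∂P := by
  refine continuous_of_dominated (bound := fun _ => 1) (fun t => ?_) (fun t => ?_)
    (integrable_const 1) (ae_of_all _ fun ω => ?_)
  · exact Measurable.aestronglyMeasurable (by fun_prop)
  · exact ae_of_all _ fun ω => by rw [Complex.norm_exp_ofReal_mul_I]
  · fun_prop

/-- The Fourier transform of the standard Gaussian at y/σ. The sign in `(-y) ^ 2` matches the use at
y = a - k. -/
theorem gaussian_density_eq_integral {σ : ℝ} (hσ : 0 < σ) (y : ℝ) :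
    ((1 / (√(2 * Real.pi) * σ) * Real.exp (-((-y) ^ 2) / (2 * σ ^ 2)) : ℝ) : ℂ) *
        (2 * Real.pi * σ) =
      ∫ s : ℝ, Complex.exp ((s / σ * y : ℝ) * Complex.I) * Complex.exp (((-s ^ 2 / 2 : ℝ) : ℂ)) := by
  have h := fourierIntegral_gaussian (b := 1 / 2) (by norm_num) ((y / σ : ℝ) : ℂ)
  have e : ∀ s : ℝ, Complex.exp ((s / σ * y : ℝ) * Complex.I) *
      Complex.exp (((-s ^ 2 / 2 : ℝ) : ℂ)) =
      Complex.exp (Complex.I * ((y / σ : ℝ) : ℂ) * s) * Complex.exp (-(1 / 2) * (s : ℂ) ^ 2) := by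
    intro s
    congr 2
    · push_cast; ring
    · push_cast; ring
  simp only [e]
  rw [h]
  have h2 : ((Real.pi : ℂ) / (1 / 2)) ^ (1 / 2 : ℂ) = ((√(2 * Real.pi) : ℝ) : ℂ) := by
    rw [Real.sqrt_eq_rpow, Complex.ofReal_cpow (by positivity)]
    congr 1
    · push_cast; ring
    · push_cast; ring
  have h3 : Complex.exp (-((y / σ : ℝ) : ℂ) ^ 2 / (4 * (1 / 2))) =
      ((Real.exp (-((-y) ^ 2) / (2 * σ ^ 2)) : ℝ) : ℂ) := by
    rw [Complex.ofReal_exp]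
    congr 1
    push_cast
    field_simp
    ring
  rw [h2, h3]
  norm_cast
  have hs : √(2 * Real.pi) * √(2 * Real.pi) = 2 * Real.pi := Real.mul_self_sqrt (by positivity)
  have hs0 : √(2 * Real.pi) ≠ 0 := by positivity
  field_simp
  rw [sq, hs]

/-- The error in a local limit theorem is controlled by the `L¹` distance between the
(truncated) characteristic function and that of the Gaussian. -/
theorem abs_measureReal_sub_gaussian_le (P : Measure Ω) [IsProbabilityMeasure P] {X : Ω → ℤ}
    (hX : Measurable X) (a : ℝ) {σ : ℝ} (hσ : 0 < σ) (k : ℤ)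
    (hDint : Integrable fun s : ℝ => (Set.Ioc (-Real.pi * σ) (Real.pi * σ)).indicator
        (fun s => ∫ ω, Complex.exp ((s / σ * (X ω - a) : ℝ) * Complex.I) ∂P) s -
          Complex.exp ((-s ^ 2 / 2 : ℝ) : ℂ)) :
    |P.real {ω | X ω = k} -
        1 / (√(2 * Real.pi) * σ) * Real.exp (-(((k : ℝ) - a) ^ 2) / (2 * σ ^ 2))| ≤
      (∫ s : ℝ, ‖(Set.Ioc (-Real.pi * σ) (Real.pi * σ)).indicator
        (fun s => ∫ ω, Complex.exp ((s / σ * (X ω - a) : ℝ) * Complex.I) ∂P) s -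
          Complex.exp ((-s ^ 2 / 2 : ℝ) : ℂ)‖) / (2 * Real.pi) * σ⁻¹ := by
  set ψ : ℝ → ℂ := fun t => ∫ ω, Complex.exp ((t * (X ω - a) : ℝ) * Complex.I) ∂P with hψ
  have hpi := Real.pi_pos
  have hgi : Integrable fun s : ℝ => Complex.exp ((-s ^ 2 / 2 : ℝ) : ℂ) := by
    have := (integrable_exp_neg_mul_sq (b := 1 / 2) (by norm_num)).ofReal (𝕜 := ℂ)
    refine this.congr (ae_of_all _ fun s => ?_)
    simp only [Complex.coe_algebraMap]
    push_cast
    ring_nf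
  have hψi : Integrable fun s : ℝ => (Set.Ioc (-Real.pi * σ) (Real.pi * σ)).indicator
      (fun s => ψ (s / σ)) s := by
    refine (hDint.add hgi).congr (ae_of_all _ fun s => ?_)
    simp [hψ]
  have h1 := measureReal_eq_integral_charFun P hX a k
  have h2 := gaussian_density_eq_integral hσ (a - k)
  rw [neg_sub] at h2
  have hunit : ∀ (f : ℝ → ℂ), Integrable f →
      Integrable fun s : ℝ => Complex.exp ((s / σ * (a - k) : ℝ) * Complex.I) * f s := by
    intro f hf
    refine hf.bdd_mul (c := 1) (Continuous.aestronglyMeasurable (by fun_prop))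
      (ae_of_all _ fun s => ?_)
    rw [Complex.norm_exp_ofReal_mul_I]
  have h3 : ((P.real {ω | X ω = k} : ℝ) : ℂ) * (2 * Real.pi * σ) =
      ∫ s : ℝ, Complex.exp ((s / σ * (a - k) : ℝ) * Complex.I) *
        (Set.Ioc (-Real.pi * σ) (Real.pi * σ)).indicator (fun s => ψ (s / σ)) s := by
    have hsc := intervalIntegral.integral_comp_div (a := -Real.pi * σ) (b := Real.pi * σ)
      (fun t : ℝ => Complex.exp ((t * (a - k) : ℝ) * Complex.I) * ψ t) hσ.ne'
    rw [mul_div_cancel_right₀ _ hσ.ne', mul_div_cancel_right₀ _ hσ.ne', ← h1,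
      intervalIntegral.integral_of_le (by nlinarith), ← integral_indicator measurableSet_Ioc] at hsc
    rw [← mul_assoc, mul_comm _ (σ : ℂ)]
    rw [Complex.real_smul] at hsc
    rw [← hsc]
    refine integral_congr_ae (ae_of_all _ fun s => ?_)
    simp only [Set.indicator_apply]
    split_ifs <;> simp
  set D : ℝ := P.real {ω | X ω = k} -
        1 / (√(2 * Real.pi) * σ) * Real.exp (-(((k : ℝ) - a) ^ 2) / (2 * σ ^ 2)) with hD
  have h4 : (D : ℂ) * (2 * Real.pi * σ) =
      ∫ s : ℝ, Complex.exp ((s / σ * (a - k) : ℝ) * Complex.I) *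
        ((Set.Ioc (-Real.pi * σ) (Real.pi * σ)).indicator (fun s => ψ (s / σ)) s -
          Complex.exp ((-s ^ 2 / 2 : ℝ) : ℂ)) := by
    simp only [mul_sub (Complex.exp _)]
    rw [integral_sub (hunit _ hψi) (hunit _ hgi), ← h3, ← h2, hD, Complex.ofReal_sub, sub_mul]
  have h5 : |D| * (2 * Real.pi * σ) ≤ ∫ s : ℝ, ‖(Set.Ioc (-Real.pi * σ) (Real.pi * σ)).indicator
      (fun s => ψ (s / σ)) s - Complex.exp ((-s ^ 2 / 2 : ℝ) : ℂ)‖ := by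
    have e : |D| * (2 * Real.pi * σ) = ‖(D : ℂ) * (2 * Real.pi * σ)‖ := by
      rw [norm_mul, Complex.norm_real, Real.norm_eq_abs]
      congr 1
      rw [show (2 * Real.pi * σ : ℂ) = ((2 * Real.pi * σ : ℝ) : ℂ) by push_cast; ring,
        Complex.norm_real, Real.norm_of_nonneg (by positivity)]
    rw [e, h4]
    refine (norm_integral_le_integral_norm _).trans (le_of_eq ?_)
    refine integral_congr_ae (ae_of_all _ fun s => ?_)
    simp only
    rw [norm_mul, Complex.norm_exp_ofReal_mul_I, one_mul]
  rw [← div_eq_mul_inv, div_div, le_div_iff₀ (by positivity)]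
  exact h5

/-- A local limit theorem follows from pointwise convergence of the characteristic functions and
a Gaussian bound for them over the whole period. -/
theorem eventually_abs_measureReal_sub_gaussian_le {Ω : ℕ → Type*} [∀ n, MeasurableSpace (Ω n)]
    (P : ∀ n, Measure (Ω n)) [∀ n, IsProbabilityMeasure (P n)] {X : ∀ n, Ω n → ℤ}
    (hX : ∀ n, Measurable (X n)) (a σ : ℕ → ℝ) (hσ : Tendsto σ atTop atTop) {c : ℝ} (hc : 0 < c)
    (hdecay : ∀ᶠ n in atTop, ∀ t : ℝ, |t| ≤ Real.pi →
      ‖∫ ω, Complex.exp ((t * (X n ω - a n) : ℝ) * Complex.I) ∂(P n)‖ ≤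
        Real.exp (-c * (σ n * t) ^ 2))
    (hclt : ∀ s : ℝ, Tendsto
      (fun n => ∫ ω, Complex.exp ((s / σ n * (X n ω - a n) : ℝ) * Complex.I) ∂(P n)) atTop
        (𝓝 (Complex.exp ((-s ^ 2 / 2 : ℝ) : ℂ))))
    {ε : ℝ} (hε : 0 < ε) : ∀ᶠ n in atTop, ∀ k : ℤ,
      |(P n).real {ω | X n ω = k} -
        1 / (√(2 * Real.pi) * σ n) * Real.exp (-(((k : ℝ) - a n) ^ 2) / (2 * σ n ^ 2))| ≤
      ε * (σ n)⁻¹ := by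
  have hpi := Real.pi_pos
  set D : ℕ → ℝ → ℂ := fun n s => (Set.Ioc (-Real.pi * σ n) (Real.pi * σ n)).indicator
        (fun s => ∫ ω, Complex.exp ((s / σ n * (X n ω - a n) : ℝ) * Complex.I) ∂(P n)) s -
          Complex.exp ((-s ^ 2 / 2 : ℝ) : ℂ) with hD
  set B : ℝ → ℝ := fun s => Real.exp (-c * s ^ 2) + Real.exp (-(1 / 2) * s ^ 2) with hB
  have hBi : Integrable B :=
    (integrable_exp_neg_mul_sq hc).add (integrable_exp_neg_mul_sq (by norm_num))
  have hDm : ∀ n, AEStronglyMeasurable (D n) := by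
    intro n
    have hXr : Measurable fun ω => (X n ω : ℝ) - a n :=
      ((measurable_from_top (f := fun m : ℤ => (m : ℝ))).comp (hX n)).sub_const _
    have h1 := (continuous_integral_exp_mul_I (P n) hXr).comp (continuous_id.div_const (σ n))
    exact (h1.aestronglyMeasurable.indicator measurableSet_Ioc).sub
      (Continuous.aestronglyMeasurable (by fun_prop))
  have hDb : ∀ᶠ n in atTop, ∀ s, ‖D n s‖ ≤ B s := by
    filter_upwards [hdecay, hσ.eventually_gt_atTop 0] with n hn hs s
    refine (norm_sub_le _ _).trans (add_le_add ?_ ?_)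
    · rw [Set.indicator_apply]
      split_ifs with h
      · have := hn (s / σ n) (by
          rw [abs_div, abs_of_pos hs, div_le_iff₀ hs, abs_le]
          exact ⟨by linarith [h.1], h.2⟩)
        rwa [mul_div_cancel₀ _ hs.ne'] at this
      · simp only [norm_zero]; positivity
    · rw [Complex.norm_exp, Complex.ofReal_re, Real.exp_le_exp]
      linarith
  have hlim : ∀ s, Tendsto (fun n => ‖D n s‖) atTop (𝓝 0) := by
    intro s
    have h1 := (hclt s).sub_const (Complex.exp ((-s ^ 2 / 2 : ℝ) : ℂ))
    rw [sub_self] at h1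
    have h2 := h1.norm
    rw [norm_zero] at h2
    refine h2.congr' ?_
    -- For fixed s, the window (-πσ, πσ] eventually contains s, so the truncation disappears in the
    -- limit.
    filter_upwards [hσ.eventually_gt_atTop (|s| / Real.pi)] with n hn
    rw [div_lt_iff₀ hpi] at hn
    have hmem : s ∈ Set.Ioc (-Real.pi * σ n) (Real.pi * σ n) := by
      have := abs_lt.1 hn
      exact ⟨by linarith [this.1], by linarith [this.2]⟩
    simp only [hD, Set.indicator_of_mem hmem]
  have hJ : Tendsto (fun n => ∫ s, ‖D n s‖) atTop (𝓝 0) := by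
    have := tendsto_integral_filter_of_dominated_convergence (μ := volume) (l := atTop)
      (F := fun n s => ‖D n s‖) (f := fun _ => (0 : ℝ)) B
      (Eventually.of_forall fun n => (hDm n).norm)
      (hDb.mono fun n hn => ae_of_all _ fun s => by rw [norm_norm]; exact hn s) hBi
      (ae_of_all _ hlim)
    simpa using this
  filter_upwards [hDb, hσ.eventually_gt_atTop 0,
    hJ.eventually_lt_const (by positivity : 0 < ε * (2 * Real.pi))] with n hn hs hJn k
  refine (abs_measureReal_sub_gaussian_le (P n) (hX n) (a n) hs k
    (hBi.mono' (hDm n) (ae_of_all _ hn))).trans ?_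
  gcongr
  rw [div_le_iff₀ (by positivity)]
  exact hJn.le

end LocalLimit

/-! ### Characteristic function of the hard-core model -/

section HardCore

theorem coe_indepPoly {V : Type*} [Finite V] (G : SimpleGraph V) (lam : ℝ≥0) :
    ((indepPoly G lam : ℝ≥0) : ℂ) = indepPoly G ((lam : ℝ) : ℂ) := by
  simp [indepPoly]

theorem integral_hardCore {V : Type*} [Finite V] (G : SimpleGraph V) (lam : ℝ≥0) {E : Type*}
    [NormedAddCommGroup E] [NormedSpace ℝ E] [CompleteSpace E] (g : IndepSet G → E) :
    ∫ I, g I ∂(hardCore G lam) =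
      ∑ I : IndepSet G, ((lam ^ I.size / indepPoly G lam : ℝ≥0) : ℝ) • g I := by
  have : Finite (IndepSet G) := Finite.of_fintype _
  have : MeasurableSingletonClass (IndepSet G) := ⟨fun _ => trivial⟩
  unfold hardCore
  rw [integral_finsetSum_measure fun I _ =>
    (integrable_dirac (by simp)).smul_measure ENNReal.coe_ne_top]
  refine Finset.sum_congr rfl fun I _ => ?_
  rw [integral_smul_measure, integral_dirac]
  simp

theorem integral_exp_size_hardCore {V : Type*} [Finite V] (G : SimpleGraph V) (lam : ℝ≥0)
    (t : ℝ) : ∫ I : IndepSet G, Complex.exp ((t * I.size : ℝ) * Complex.I) ∂(hardCore G lam) =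
      indepPoly G (((lam : ℝ) : ℂ) * Complex.exp (t * Complex.I)) /
        indepPoly G ((lam : ℝ) : ℂ) := by
  rw [integral_hardCore, ← coe_indepPoly]
  conv_rhs => rw [indepPoly, Finset.sum_div]
  refine Finset.sum_congr rfl fun I _ => ?_
  rw [mul_pow, ← Complex.exp_nat_mul, Complex.real_smul]
  push_cast
  rw [show (t : ℂ) * I.size * Complex.I = I.size * (t * Complex.I) by ring]
  ring

/-- The weight `g` allows a second application, which yields the second moment. -/
theorem hasDerivAt_integral_hardCore {V : Type*} [Finite V] (G : SimpleGraph V) (lam : ℝ≥0)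
    (g : IndepSet G → ℂ) (t : ℝ) :
    HasDerivAt (fun t : ℝ => ∫ I : IndepSet G, g I * Complex.exp ((t * I.size : ℝ) * Complex.I)
        ∂(hardCore G lam))
      (∫ I : IndepSet G, g I * (I.size * Complex.I) * Complex.exp ((t * I.size : ℝ) * Complex.I)
        ∂(hardCore G lam)) t := by
  simp only [integral_hardCore]
  refine HasDerivAt.fun_sum fun I _ => HasDerivAt.const_smul _ ?_
  have h1 : HasDerivAt (fun t : ℝ => (((t * I.size : ℝ) : ℂ) * Complex.I))
      (I.size * Complex.I) t := by
    simpa using (((hasDerivAt_id t).mul_const (I.size : ℝ)).ofReal_comp).mul_const Complex.I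
  exact (h1.cexp.const_mul (g I)).congr_deriv (by ring)

/-- Variance and characteristic function of the size of a hard-core random set at low fugacity. -/
theorem hardCore_charFun_bounds {V : Type*} [Fintype V] {G : SimpleGraph V} {Δ : ℕ}
    (hΔ : 3 ≤ Δ) (hG : DegreeAtMost G Δ) {lam : ℝ≥0}
    (hlam : (lam : ℝ) ≤ 1 / (100 * (Δ : ℝ) ^ 2)) {N a v : ℝ} (hN : N = Fintype.card V * lam)
    (ha : a = ∫ I : IndepSet G, (((I.size : ℤ)) : ℝ) ∂(hardCore G lam))
    (hv : v = variance (fun I : IndepSet G => ((I.size : ℤ) : ℝ)) (hardCore G lam)) :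
    |v - N| ≤ N / 2 ∧ ∀ t : ℝ, ∃ w : ℂ,
      ∫ I : IndepSet G, Complex.exp ((t * ((I.size : ℤ) - a) : ℝ) * Complex.I) ∂(hardCore G lam) =
        Complex.exp w ∧
      ‖w + v * t ^ 2 / 2‖ ≤ 16 * N * |t| ^ 3 ∧
      ‖Complex.exp w‖ ≤ Real.exp (-(N / 2) * (1 - Real.cos t)) := by
  have : Finite (IndepSet G) := Finite.of_fintype _
  have : MeasurableSingletonClass (IndepSet G) := ⟨fun _ => trivial⟩
  simp only [Int.cast_natCast] at ha hv ⊢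
  have hN0 : 0 ≤ N := hN ▸ by positivity
  obtain ⟨u, hu0, hu, hexp⟩ := exists_trigSeries_log_indepPoly hΔ hG lam.2 hlam
  rw [NNReal.val_eq_coe, ← hN] at hu0
  simp only [NNReal.val_eq_coe, ← hN] at hu hexp
  set φ : ℝ → ℂ := fun t =>
    ∫ I : IndepSet G, Complex.exp ((t * I.size : ℝ) * Complex.I) ∂(hardCore G lam) with hφdef
  have hZ : indepPoly G ((lam : ℝ) : ℂ) ≠ 0 := by
    rw [← coe_indepPoly]
    exact_mod_cast (indepPoly_pos G lam).ne'
  have hφ : ∀ t : ℝ, φ t =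
      Complex.exp (∑' j : ℕ, u j * (Complex.exp (((j + 1) * t : ℝ) * Complex.I) - 1)) := by
    intro t
    rw [hφdef]
    simp only
    rw [integral_exp_size_hardCore, hexp, mul_div_cancel_left₀ _ hZ]
  have hd1 := hasDerivAt_integral_hardCore G lam (fun _ => 1)
  have hd2 := hasDerivAt_integral_hardCore G lam (fun I => 1 * (I.size * Complex.I)) 0
  simp only [one_mul] at hd1 hd2
  obtain ⟨m1, m2⟩ := moments_of_eq_exp_trigSeries hN0 hu hφ hd1 hd2
  have i1 : (∫ I : IndepSet G, (I.size * Complex.I) * Complex.exp ((0 * I.size : ℝ) * Complex.I)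
      ∂(hardCore G lam)) = a * Complex.I := by
    simp only [zero_mul, Complex.ofReal_zero, Complex.exp_zero, mul_one]
    rw [integral_mul_const, ha, ← integral_complex_ofReal]
    simp
  have i2 : (∫ I : IndepSet G, (I.size * Complex.I) * (I.size * Complex.I) *
      Complex.exp ((0 * I.size : ℝ) * Complex.I) ∂(hardCore G lam)) =
      -((∫ I : IndepSet G, (I.size : ℝ) ^ 2 ∂(hardCore G lam) : ℝ) : ℂ) := by
    simp only [zero_mul, Complex.ofReal_zero, Complex.exp_zero, mul_one]
    rw [← integral_complex_ofReal, ← integral_neg]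
    refine integral_congr_ae (ae_of_all _ fun I => ?_)
    simp only
    push_cast
    linear_combination (I.size : ℂ) ^ 2 * Complex.I_sq
  rw [i1] at m1 m2
  rw [i2] at m2
  have hvar : v = (∫ I : IndepSet G, (I.size : ℝ) ^ 2 ∂(hardCore G lam)) - a ^ 2 := by
    rw [hv, variance_eq_sub MemLp.of_discrete, ha]
    simp
  -- Comparing derivatives at 0 identifies the first two weighted sums of the u_j with the mean and
  -- the variance.
  have hA : (∑' j : ℕ, u j * ((j : ℂ) + 1) ^ 1) = (a : ℂ) :=
    (mul_right_cancel₀ Complex.I_ne_zero m1).symm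
  have hBv : (∑' j : ℕ, u j * ((j : ℂ) + 1) ^ 2) = (v : ℂ) := by
    rw [hvar]
    push_cast
    linear_combination m2 + (a : ℂ) ^ 2 * Complex.I_sq
  have hψ : ∀ t : ℝ, ∫ I : IndepSet G, Complex.exp ((t * (I.size - a) : ℝ) * Complex.I)
      ∂(hardCore G lam) = φ t * Complex.exp (-(a * t * Complex.I)) := by
    intro t
    rw [hφdef]
    simp only
    rw [← integral_mul_const]
    refine integral_congr_ae (ae_of_all _ fun I => ?_)
    simp only
    rw [← Complex.exp_add]
    congr 1
    push_cast
    ring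
  have hconj : ∀ t : ℝ, ‖φ (-t)‖ = ‖φ t‖ := by
    intro t
    have : φ (-t) = (starRingEnd ℂ) (φ t) := by
      rw [hφdef]
      simp only
      rw [← integral_conj]
      refine integral_congr_ae (ae_of_all _ fun I => ?_)
      simp only
      rw [← Complex.exp_conj, map_mul, Complex.conj_ofReal, Complex.conj_I]
      congr 1
      push_cast
      ring
    rw [this, Complex.norm_conj]
  constructor
  · have := norm_tsum_mul_succ_sq_sub_le hN0 hu hu0
    rw [hBv] at this
    rwa [← Complex.ofReal_sub, Complex.norm_real, Real.norm_eq_abs] at this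
  · intro t
    -- Centring subtracts iat, which cancels the linear term of the expansion and leaves the modulus
    -- unchanged.
    refine ⟨(∑' j : ℕ, u j * (Complex.exp (((j + 1) * t : ℝ) * Complex.I) - 1)) -
      a * t * Complex.I, ?_, ?_, ?_⟩
    · rw [hψ, hφ, ← Complex.exp_add, sub_eq_add_neg]
    · have := norm_trigSeries_sub_quadratic_le hN0 hu t
      rw [hA, hBv] at this
      refine le_of_eq_of_le ?_ this
      congr 1
      ring
    · have h := hconj t
      rw [hφ, hφ] at h
      have := norm_exp_trigSeries_le hN0 hu hu0 t h
      rw [sub_eq_add_neg, Complex.exp_add, norm_mul]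
      rw [show -((a : ℂ) * t * Complex.I) = ((-(a * t) : ℝ) : ℂ) * Complex.I by push_cast; ring,
        Complex.norm_exp_ofReal_mul_I, mul_one]
      exact this

end HardCore

/-! ### The local central limit theorem -/

theorem theorem6p4 (Δ : ℕ) (hΔ : 3 ≤ Δ)
    (G : ∀ n : ℕ, SimpleGraph (Fin n)) [∀ n, DecidableRel (G n).Adj]
    (hG : ∀ n, (G n).maxDegree ≤ Δ)
    (lam : ℕ → ℝ≥0)
    (hlam_large : Tendsto (fun n : ℕ => (n : ℝ) * (lam n : ℝ)) atTop atTop)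
    (hlam_small : ∀ n, (lam n : ℝ) ≤ 1 / (100 * (Δ : ℝ) ^ 2)) :
    SatisfiesLCLT (fun n => hardCore (G n) (lam n))
      (fun n (I : IndepSet (G n)) => (I.size : ℤ)) := by
  have hdeg : ∀ n, DegreeAtMost (G n) Δ := by
    intro n v T hT
    refine le_trans ?_ (((G n).degree_le_maxDegree v).trans (hG n))
    rw [← SimpleGraph.card_neighborFinset_eq_degree]
    exact Finset.card_le_card fun u hu => by simpa using hT u hu
  set N : ℕ → ℝ := fun n => n * lam n with hN
  set a : ℕ → ℝ := fun n => ∫ I : IndepSet (G n), ((I.size : ℤ) : ℝ) ∂(hardCore (G n) (lam n))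
    with ha
  set v : ℕ → ℝ := fun n =>
    variance (fun I : IndepSet (G n) => ((I.size : ℤ) : ℝ)) (hardCore (G n) (lam n)) with hv
  have key := fun n => hardCore_charFun_bounds (N := N n) (a := a n) (v := v n) hΔ (hdeg n)
    (hlam_small n) (by simp [hN]) rfl rfl
  have hv0 : ∀ n, 0 ≤ v n := fun n => variance_nonneg _ _
  have hsq : ∀ n, √(v n) ^ 2 = v n := fun n => Real.sq_sqrt (hv0 n)
  have hvN : ∀ n, N n ≤ 2 * v n ∧ v n ≤ 3 / 2 * N n := by
    intro n
    have := abs_le.1 (key n).1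
    constructor <;> linarith [this.1, this.2]
  have hvt : Tendsto v atTop atTop :=
    tendsto_atTop_mono (fun n => by linarith [(hvN n).1])
      (hlam_large.atTop_mul_const (by norm_num : (0 : ℝ) < 1 / 2))
  have hσ : Tendsto (fun n => √(v n)) atTop atTop := Real.tendsto_sqrt_atTop.comp hvt
  intro ε hε
  -- The constant c: on |t| ≤ π, 1 - cos t ≥ 2t²/π², so the exponent is at most -N t²/π², and N ≥
  -- (2/3)σ².
  refine eventually_abs_measureReal_sub_gaussian_le (fun n => hardCore (G n) (lam n))
    (fun n => measurable_from_top) a (fun n => √(v n)) hσ (c := 2 / (3 * Real.pi ^ 2))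
    (by positivity) ?_ ?_ hε
  · refine Eventually.of_forall fun n t ht => ?_
    obtain ⟨w, hw, -, hw2⟩ := (key n).2 t
    rw [hw]
    refine hw2.trans (Real.exp_le_exp.2 ?_)
    rw [mul_pow, hsq]
    have hcos := Real.cos_le_one_sub_mul_cos_sq ht
    have hN0 : 0 ≤ N n := by positivity
    have h1 : N n / 2 * (2 / Real.pi ^ 2 * t ^ 2) ≤ N n / 2 * (1 - Real.cos t) :=
      mul_le_mul_of_nonneg_left (by linarith) (by linarith)
    have h2 : v n * (2 / (3 * Real.pi ^ 2) * t ^ 2) ≤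
        3 / 2 * N n * (2 / (3 * Real.pi ^ 2) * t ^ 2) :=
      mul_le_mul_of_nonneg_right (hvN n).2 (by positivity)
    have e : 3 / 2 * N n * (2 / (3 * Real.pi ^ 2) * t ^ 2) =
        N n / 2 * (2 / Real.pi ^ 2 * t ^ 2) := by field_simp
    linarith
  · intro s
    choose w hw hw1 _ using fun n => (key n).2 (s / √(v n))
    simp only [hw]
    refine (Complex.continuous_exp.tendsto _).comp ?_
    rw [tendsto_iff_norm_sub_tendsto_zero]
    -- The cubic error 16N|t|³ at t = s/σ, with N ≤ 2σ².
    have hlim : Tendsto (fun n => 32 * |s| ^ 3 / √(v n)) atTop (𝓝 0) :=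
      hσ.const_div_atTop _
    refine squeeze_zero' (Eventually.of_forall fun n => norm_nonneg _) ?_ hlim
    filter_upwards [hσ.eventually_gt_atTop 0] with n hs
    have h1 := hw1 n
    have e : w n - ((-s ^ 2 / 2 : ℝ) : ℂ) = w n + v n * ((s / √(v n) : ℝ) : ℂ) ^ 2 / 2 := by
      have : v n * (s / √(v n)) ^ 2 = s ^ 2 := by
        rw [div_pow, hsq, mul_div_cancel₀]
        rw [← hsq]; positivity
      have h' : (v n : ℂ) * ((s / √(v n) : ℝ) : ℂ) ^ 2 = (s : ℂ) ^ 2 := by exact_mod_cast this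
      rw [h']
      push_cast
      ring
    rw [e]
    refine h1.trans ?_
    rw [abs_div, abs_of_pos hs, div_pow]
    calc 16 * N n * (|s| ^ 3 / √(v n) ^ 3) ≤ 16 * (2 * √(v n) ^ 2) * (|s| ^ 3 / √(v n) ^ 3) := by
          gcongr
          rw [hsq]
          exact (hvN n).1
      _ = 32 * |s| ^ 3 / √(v n) := by field_simp; ring
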